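/- Let $k$ be a field and let $\mathcal C$ be a finite EI category, i.e. a category with finitely many morphisms in which every endomorphism is an isomorphism. Let $k\mathcal C$ be its category algebra: the unital $k$-algebra with $k$-basis the set of morphisms of $\mathcal C$, in which the product $g\cdot f$ of two morphisms is the composite $g\circ f$ if the target of $f$ is the source of $g$, and $0$ otherwise. Let $\ell(\mathcal C)$ be the supremum of the lengths $n$ of chains $x_0\to x_1\to\dots\to x_n$ of composable morphisms of $\mathcal C$ none of which is an isomorphism (with $\ell(\mathcal C)=0$ if $\mathcal C$ is empty). All modules are left modules, and the zero module has projective dimension $-\infty$. Then: 1. The global dimension of $k\mathcal C$ (the supremum of the projective dimensions of all $k\mathcal C$-modules) is finite (less than $+\infty$) if and only if $|\operatorname{Aut}(x)|$ is invertible in $k$ for every object $x$ of $\mathcal C$. 2. $\ell(\mathcal C)$ is finite, and $$\operatorname{Fin.dim}(k\mathcal C)=\sup\{\operatorname{proj.dim} M \mid M\in\operatorname{Mod}(k\mathcal C),\ \operatorname{proj.dim}M<\infty\}\le \ell(\mathcal C),$$ where $\operatorname{Mod}(k\mathcal C)$ is the category of all, not necessarily finitely generated, $k\mathcal C$-modules.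 -/

import Mathlib

open CategoryTheory

universe uk u v

section CategoryAlgebra

variable (k : Type uk) (C : Type u) [Category.{v} C]

/-- The set of all morphisms of `C`: triples consisting of a source, a target and a morphism. -/
abbrev Mor : Type (max u v) := Σ x y : C, x ⟶ y

/-- The underlying `k`-vector space of the category algebra `kC`: the formal `k`-linear
combinations of morphisms of `C`. -/
def CategoryAlgebra [Field k] : Type (max uk u v) := Mor C →₀ k

namespace CategoryAlgebra

variable [Field k]

noncomputable instance : AddCommGroup (CategoryAlgebra k C) :=
  inferInstanceAs (AddCommGroup (Mor C →₀ k))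

noncomputable instance : Module k (CategoryAlgebra k C) :=
  inferInstanceAs (Module k (Mor C →₀ k))

/-- The basis of `kC` formed by the morphisms of `C`. -/
noncomputable def basis : Module.Basis (Mor C) k (CategoryAlgebra k C) :=
  Module.Basis.ofRepr (LinearEquiv.refl k (Mor C →₀ k))

variable {k C}

/-- The basis vector given by a morphism `f : x ⟶ y`. -/
noncomputable def of {x y : C} (f : x ⟶ y) : CategoryAlgebra k C := basis k C ⟨x, y, f⟩

open Classical in
/-- The product `g * f` of two basis vectors: the composite `g ∘ f` (first `f`, then `g`, which is
`f ≫ g`) if the target of `f` is the source of `g`, and zero otherwise. -/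
noncomputable def mulMor (g f : Mor C) : CategoryAlgebra k C :=
  if h : f.2.1 = g.1 then of (f.2.2 ≫ eqToHom h ≫ g.2.2) else 0

variable (k C) in
/-- The multiplication of `kC`: the bilinear extension of `mulMor`. -/
noncomputable def mulLin :
    CategoryAlgebra k C →ₗ[k] CategoryAlgebra k C →ₗ[k] CategoryAlgebra k C :=
  (basis k C).constr k fun g => (basis k C).constr k fun f => mulMor g f

noncomputable instance : Mul (CategoryAlgebra k C) := ⟨fun a b => mulLin k C a b⟩

/-- The unit of `kC`, for a category with finitely many objects: the sum of all identities. -/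
noncomputable instance [Finite C] : One (CategoryAlgebra k C) := ⟨∑ᶠ x : C, of (𝟙 x)⟩

theorem mul_def (a b : CategoryAlgebra k C) : a * b = mulLin k C a b := rfl

theorem basis_mul_basis (g f : Mor C) : basis k C g * basis k C f = mulMor g f := by
  simp [mul_def, mulLin]

theorem of_mul_of {x y z : C} (g : y ⟶ z) (f : x ⟶ y) :
    (of g * of f : CategoryAlgebra k C) = of (f ≫ g) := by
  rw [of, of, basis_mul_basis]
  simp [mulMor]

theorem of_mul_of_ne {x y y' z : C} (g : y' ⟶ z) (f : x ⟶ y) (h : y ≠ y') :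
    (of g * of f : CategoryAlgebra k C) = 0 := by
  rw [of, of, basis_mul_basis]
  simp [mulMor, h]

theorem mul_assoc_of {x₁ y₁ x₂ y₂ x₃ y₃ : C} (a : x₁ ⟶ y₁) (b : x₂ ⟶ y₂) (c : x₃ ⟶ y₃) :
    (of a * of b * of c : CategoryAlgebra k C) = of a * (of b * of c) := by
  have h0 (t : CategoryAlgebra k C) : 0 * t = 0 := by simp [mul_def]
  have h1 (t : CategoryAlgebra k C) : t * 0 = 0 := by simp [mul_def]
  by_cases h : y₂ = x₁
  · subst h
    by_cases h' : y₃ = x₂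
    · subst h'
      simp only [of_mul_of, Category.assoc]
    · rw [of_mul_of, of_mul_of_ne _ _ h', of_mul_of_ne _ _ h', h1]
  · rw [of_mul_of_ne _ _ h, h0]
    by_cases h' : y₃ = x₂
    · subst h'
      rw [of_mul_of, of_mul_of_ne _ _ h]
    · rw [of_mul_of_ne _ _ h', h1]

protected theorem mul_assoc (a b c : CategoryAlgebra k C) : a * b * c = a * (b * c) := by
  have key : (mulLin k C).compr₂ (mulLin k C) =
      (LinearMap.llcomp k (CategoryAlgebra k C) (CategoryAlgebra k C)
        (CategoryAlgebra k C)).compl₁₂ (mulLin k C) (mulLin k C) := by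
    refine (basis k C).ext fun a => (basis k C).ext fun b => (basis k C).ext fun c => ?_
    exact mul_assoc_of a.2.2 b.2.2 c.2.2
  exact LinearMap.congr_fun (LinearMap.congr_fun (LinearMap.congr_fun key a) b) c

theorem one_def [Fintype C] : (1 : CategoryAlgebra k C) = ∑ x : C, of (𝟙 x) :=
  finsum_eq_sum_of_fintype _

protected theorem one_mul [Finite C] (a : CategoryAlgebra k C) : 1 * a = a := by
  have := Fintype.ofFinite C
  have key : mulLin k C 1 = LinearMap.id := by
    refine (basis k C).ext fun ⟨x, y, f⟩ => ?_
    change 1 * of f = of f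
    rw [one_def, mul_def, map_sum, LinearMap.sum_apply, Finset.sum_eq_single y]
    · rw [← mul_def, of_mul_of, Category.comp_id]
    · intro z _ hz
      rw [← mul_def, of_mul_of_ne _ _ hz.symm]
    · simp
  exact LinearMap.congr_fun key a

protected theorem mul_one [Finite C] (a : CategoryAlgebra k C) : a * 1 = a := by
  have := Fintype.ofFinite C
  have key : (mulLin k C).flip 1 = LinearMap.id := by
    refine (basis k C).ext fun ⟨x, y, f⟩ => ?_
    change of f * 1 = of f
    rw [one_def, mul_def, map_sum, Finset.sum_eq_single x]
    · rw [← mul_def, of_mul_of, Category.id_comp]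
    · intro z _ hz
      rw [← mul_def, of_mul_of_ne _ _ hz]
    · simp
  exact LinearMap.congr_fun key a

noncomputable instance [Finite C] : Ring (CategoryAlgebra k C) :=
  { (inferInstance : AddCommGroup (CategoryAlgebra k C)) with
    mul := (· * ·)
    one := 1
    mul_assoc := CategoryAlgebra.mul_assoc
    one_mul := CategoryAlgebra.one_mul
    mul_one := CategoryAlgebra.mul_one
    left_distrib := fun a b c => map_add (mulLin k C a) b c
    right_distrib := fun a b c => LinearMap.map_add₂ (mulLin k C) a b c
    zero_mul := fun a => LinearMap.map_zero₂ (mulLin k C) a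
    mul_zero := fun a => map_zero (mulLin k C a) }

noncomputable instance [Finite C] : Algebra k (CategoryAlgebra k C) :=
  Algebra.ofModule (fun r a b => LinearMap.map_smul₂ (mulLin k C) r a b)
    (fun r a b => map_smul (mulLin k C a) r b)

end CategoryAlgebra

end CategoryAlgebra

/-- `C` is an EI category: every endomorphism is an isomorphism. -/
def IsEICategory (C : Type u) [Category.{v} C] : Prop :=
  ∀ (x : C) (f : x ⟶ x), IsIso f

/-- `ℓ(C)`: the supremum of the lengths `n` of chains `x₀ ⟶ x₁ ⟶ ⋯ ⟶ xₙ` in `C` all of whose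
`n` morphisms are non-isomorphisms (and `0` if `C` is empty). -/
noncomputable def chainLength (C : Type u) [Category.{v} C] : ℕ∞ :=
  ⨆ (n : ℕ) (F : ComposableArrows C n)
    (_ : ∀ (i : ℕ) (hi : i < n), ¬ IsIso (F.map' i (i + 1))), (n : ℕ∞)

/-- The (left) global dimension of `R`: the supremum of the projective dimensions of all left
`R`-modules. The zero module has projective dimension `⊥`. -/
noncomputable def globalDimension (R : Type u) [Ring R] : WithBot ℕ∞ :=
  ⨆ M : ModuleCat.{u} R, projectiveDimension M

/-- The big (left) finitistic dimension of `R`: the supremum of the projective dimensions of all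
left `R`-modules, not necessarily finitely generated, of finite projective dimension. -/
noncomputable def bigFinitisticDimension (R : Type u) [Ring R] : WithBot ℕ∞ :=
  ⨆ (M : ModuleCat.{u} R) (_ : projectiveDimension M < ⊤), projectiveDimension M

/-! Give each object a level: the length of a longest chain of non-isomorphisms starting there.
Morphisms never raise the level, and a morphism between objects of equal level is invertible, so
each level is a finite groupoid. Let `M` be supported on levels at most `n`, and let `e` be the
idempotent of level `n` in `R = kC`. Since `∑ g ⊗ g⁻¹` is a Casimir element for `eRe`, Higman's
criterion applies: `eM` is projective over `eRe` when `e` acts on `M` as a trace `∑ g φ g⁻¹`.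

If `M` has finite projective dimension, it passes this test: projectives do, and so does the
quotient of a passing module by a passing submodule (`IsRelProjective.of_exact`). If `M` passes,
some projective maps onto it, bijectively at level `n`, so the kernel lives on lower levels
(`exists_cover`). Each level thus costs at most one dimension, which gives the bound by
`chainLength`.

If all `|Aut x|` are invertible, averaging makes every module pass, so the same bound holds for all
modules. Conversely, the test applied to the trivial representation on one isomorphism class
produces an inverse of `|Aut x₀|`. -/

open TensorProduct

/-! ### Casimir elements and Higman's criterion. -/

/-- A family of pairs in a `k`-algebra `R` whose sum of tensors `∑ aᵢ ⊗ bᵢ` is a Casimir element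
for the corner ring `e R e`. -/
structure CasimirFamily (k R ι : Type*) [Field k] [Ring R] [Algebra k R] [Fintype ι] where
  fst : ι → R
  snd : ι → R
  e : R
  e_mul_fst (i : ι) : e * fst i = fst i
  fst_mul_e (i : ι) : fst i * e = fst i
  e_mul_snd (i : ι) : e * snd i = snd i
  snd_mul_e (i : ι) : snd i * e = snd i
  e_mul_e : e * e = e
  casimir (r : R) : ∑ i, fst i ⊗ₜ[k] (snd i * (e * r * e)) = ∑ i, (e * r * e * fst i) ⊗ₜ[k] snd i

namespace CasimirFamily

variable {k R ι : Type*} [Field k] [Ring R] [Algebra k R] [Fintype ι]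
  (D : CasimirFamily k R ι)
  {M N Q : Type*} [AddCommGroup M] [Module R M] [Module k M] [IsScalarTower k R M]
  [AddCommGroup N] [Module R N] [Module k N] [IsScalarTower k R N]
  [AddCommGroup Q] [Module R Q] [Module k Q] [IsScalarTower k R Q]

/-- The averaged map `m ↦ ∑ aᵢ ψ (bᵢ m)`. -/
def trace (ψ : M →ₗ[k] N) : M →ₗ[k] N :=
  ∑ i, Algebra.lsmul k k N (D.fst i) ∘ₗ ψ ∘ₗ Algebra.lsmul k k M (D.snd i)

theorem trace_apply (ψ : M →ₗ[k] N) (m : M) :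
    D.trace ψ m = ∑ i, D.fst i • ψ (D.snd i • m) := by
  simp [trace]

/-- The Casimir identity moves an element of `eRe` from the right tensor factor to the left one;
apply to it the map `x ⊗ y ↦ x • ψ (y • m)`. -/
theorem trace_smul (ψ : M →ₗ[k] N) (r : R) (m : M) :
    D.trace ψ ((D.e * r * D.e) • m) = (D.e * r * D.e) • D.trace ψ m := by
  let B : R →ₗ[k] R →ₗ[k] N := LinearMap.mk₂ k (fun x y => x • ψ (y • m))
    (fun x x' y => add_smul _ _ _) (fun c x y => smul_assoc _ _ _)
    (fun x y y' => by rw [add_smul, map_add, smul_add])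
    (fun c x y => by rw [smul_assoc, map_smul, smul_algebra_smul_comm])
  have h := congrArg (TensorProduct.lift B) (D.casimir r)
  simp only [map_sum, TensorProduct.lift.tmul, B, LinearMap.mk₂_apply] at h
  rw [trace_apply, trace_apply, Finset.smul_sum]
  simpa only [mul_smul] using h

theorem e_smul_trace (ψ : M →ₗ[k] N) (m : M) : D.e • D.trace ψ m = D.trace ψ m := by
  simp only [trace_apply, Finset.smul_sum, ← mul_smul, D.e_mul_fst]

theorem trace_e_smul (ψ : M →ₗ[k] N) (m : M) : D.trace ψ (D.e • m) = D.trace ψ m := by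
  simp only [trace_apply, ← mul_smul, D.snd_mul_e]

theorem trace_comp (ψ : M →ₗ[k] N) (f : N →ₗ[R] Q) (m : M) :
    D.trace (f.restrictScalars k ∘ₗ ψ) m = f (D.trace ψ m) := by
  simp [trace_apply]

/-- Relative projectivity of the `e R e`-module `e M` over `k`: multiplication by `e` is a trace. -/
def IsRelProjective (M : Type*) [AddCommGroup M] [Module R M] [Module k M]
    [IsScalarTower k R M] : Prop :=
  ∃ φ : M →ₗ[k] M, ∀ m, D.trace φ m = D.e • m

theorem e_mul_snd_mul_e (i : ι) : D.e * D.snd i * D.e = D.snd i := by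
  rw [D.e_mul_snd, D.snd_mul_e]

/-- The quotient of a relatively projective module by a relatively projective submodule is
relatively projective. -/
theorem IsRelProjective.of_exact {f : M →ₗ[R] N} {g : N →ₗ[R] Q} (hf : Function.Injective f)
    (hg : Function.Surjective g) (hfg : Function.Exact f g)
    (hM : D.IsRelProjective M) (hN : D.IsRelProjective N) : D.IsRelProjective Q := by
  obtain ⟨φM, hM⟩ := hM
  obtain ⟨φN, hN⟩ := hN
  obtain ⟨r, hr⟩ := (f.restrictScalars k).exists_leftInverse_of_injective
    (LinearMap.ker_eq_bot.2 hf)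
  obtain ⟨t, ht⟩ := (g.restrictScalars k).exists_rightInverse_of_surjective
    (LinearMap.range_eq_top.2 hg)
  replace hr (m : M) : r (f m) = m := LinearMap.congr_fun hr m
  replace ht (q : Q) : g (t q) = q := LinearMap.congr_fun ht q
  -- The traced retraction is `eRe`-linear and restricts to `e` on `M`. Hence `σ` kills the image of
  -- `f` and factors through `g`, giving an `eRe`-linear splitting of `g` on the `e`-parts.
  let σ : N →ₗ[k] N := Algebra.lsmul k k N D.e - f.restrictScalars k ∘ₗ D.trace (φM ∘ₗ r)
  have hσ (n : N) : σ n = D.e • n - f (D.trace (φM ∘ₗ r) n) := rfl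
  have hρ (m : M) : D.trace (φM ∘ₗ r) (f m) = D.e • m := by
    rw [← hM, trace_apply, trace_apply]
    simp only [← map_smul, LinearMap.comp_apply, hr]
  have hσf (m : M) : σ (f m) = 0 := by rw [hσ, hρ, map_smul, sub_self]
  have hσt (n : N) : σ (t (g n)) = σ n := by
    have h : g (t (g n) - n) = 0 := by rw [map_sub, ht, sub_self]
    obtain ⟨m, hm⟩ := (hfg _).1 h
    rw [← sub_eq_zero, ← map_sub, ← hm, hσf]
  have hσb (i : ι) (n : N) : σ (D.snd i • n) = D.snd i • σ n := by
    have h := D.trace_smul (φM ∘ₗ r) (D.snd i) n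
    rw [e_mul_snd_mul_e] at h
    rw [hσ, hσ, h, smul_sub, map_smul, ← mul_smul, ← mul_smul, D.e_mul_snd, D.snd_mul_e]
  have hgσ (n : N) : g (σ n) = D.e • g n := by
    rw [hσ, map_sub, map_smul, hfg.apply_apply_eq_zero, sub_zero]
  -- Transport `φN` along the splitting `σ ∘ t`. This commutes with each `bᵢ` although `t` alone is
  -- only `k`-linear.
  refine ⟨g.restrictScalars k ∘ₗ φN ∘ₗ σ ∘ₗ t, fun q => ?_⟩
  have h1 (i : ι) : σ (t (D.snd i • q)) = D.snd i • σ (t q) := by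
    rw [← ht q, ← map_smul, hσt, hσb, ht]
  rw [trace_comp, trace_apply]
  simp only [LinearMap.comp_apply, h1]
  rw [← trace_apply, hN, map_smul, hgσ, ← mul_smul, D.e_mul_e, ht]

end CasimirFamily

/-! ### Projective modules cut out of `R ⊗ M` by idempotents. -/

section Resolution

variable {k R M : Type*} [Field k] [Ring R] [Algebra k R] [AddCommGroup M] [Module k M]

/-- The `R`-linear extension of a `k`-linear map `M → N` to `R ⊗ M`. -/
noncomputable def extendLin {N : Type*} [AddCommGroup N] [Module R N]
    [Module k N] [IsScalarTower k R N] (σ : M →ₗ[k] N) : R ⊗[k] M →ₗ[R] N :=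
  AlgebraTensorModule.lift
    { toFun := fun r => Algebra.lsmul k k N r ∘ₗ σ
      map_add' := fun r r' => by ext; simp
      map_smul' := fun r r' => by ext; simp }

@[simp]
theorem extendLin_tmul {N : Type*} [AddCommGroup N] [Module R N] [Module k N]
    [IsScalarTower k R N] (σ : M →ₗ[k] N) (r : R) (m : M) :
    extendLin σ (r ⊗ₜ[k] m) = r • σ m := rfl

theorem extendLin_comp_extendLin {σ : M →ₗ[k] R ⊗[k] M}
    (h : ∀ m, extendLin (R := R) σ (σ m) = σ m) (t : R ⊗[k] M) :
    extendLin (R := R) σ (extendLin (R := R) σ t) = extendLin (R := R) σ t := by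
  induction t with
  | zero => simp
  | add x y hx hy => simp only [map_add, hx, hy]
  | tmul r m => rw [extendLin_tmul, map_smul, h]

/-- The hypothesis makes the extension of `σ` an idempotent endomorphism, and `R ⊗ M` is free
because `k` is a field. -/
theorem projective_range_extendLin {σ : M →ₗ[k] R ⊗[k] M}
    (h : ∀ m, extendLin (R := R) σ (σ m) = σ m) :
    Module.Projective R (LinearMap.range (extendLin (R := R) σ)) := by
  have : Module.Free R (R ⊗[k] M) := 
    .of_basis (Algebra.TensorProduct.basis R (Module.Free.chooseBasis k M))
  refine Module.Projective.of_split (LinearMap.range (extendLin (R := R) σ)).subtype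
    (extendLin (R := R) σ).rangeRestrict ?_
  ext ⟨_, t, rfl⟩
  simp [extendLin_comp_extendLin h]

theorem smul_extendLin {N : Type*} [AddCommGroup N] [Module R N] [Module k N]
    [IsScalarTower k R N] {σ : M →ₗ[k] N} {c : R} (hc : ∀ r, c * r * c = r * c)
    (hσ : ∀ m, c • σ m = σ m) (t : R ⊗[k] M) :
    c • extendLin (R := R) σ t = extendLin (R := R) σ t := by
  induction t with
  | zero => simp
  | add x y hx hy => simp only [map_add, smul_add, hx, hy]
  | tmul r m => rw [extendLin_tmul, ← hσ, ← mul_smul, ← mul_smul, hc, mul_smul]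

variable [Module R M] [IsScalarTower k R M]

variable (k R M) in
/-- The action map `R ⊗ M → M`. -/
noncomputable def actionMap : R ⊗[k] M →ₗ[R] M := extendLin LinearMap.id

@[simp]
theorem actionMap_tmul (r : R) (m : M) : actionMap k R M (r ⊗ₜ m) = r • m := rfl

/-- An `R`-module `P` which is a direct summand of `R ⊗ M`, given by a `k`-linear section of the
action map. -/
theorem exists_projective_cover {k : Type*} {R M : Type u} [Field k] [Ring R] [Algebra k R]
    [AddCommGroup M] [Module k M] [Module R M] [IsScalarTower k R M]
    {σ : M →ₗ[k] R ⊗[k] M}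
    (hσ : ∀ m, extendLin (R := R) σ (σ m) = σ m) (hact : ∀ m, actionMap k R M (σ m) = m) :
    ∃ (P : Type u) (_ : AddCommGroup P) (_ : Module R P) (_ : Module k P) (_ : IsScalarTower k R P)
      (π : P →ₗ[R] M) (j : P →ₗ[R] R ⊗[k] M), Module.Projective R P ∧ Function.Surjective π ∧
      Function.Injective j ∧ (∀ p, ∃ t, j p = extendLin (R := R) σ t) ∧
      ∀ p, π p = actionMap k R M (j p) := by
  let P := LinearMap.range (extendLin (R := R) σ)
  refine ⟨P, inferInstance, inferInstance, inferInstance, inferInstance,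
    actionMap k R M ∘ₗ P.subtype, P.subtype, projective_range_extendLin hσ,
    fun m => ⟨⟨σ m, 1 ⊗ₜ m, by simp⟩, hact m⟩, P.subtype_injective, ?_, fun p => rfl⟩
  rintro ⟨_, t, rfl⟩
  exact ⟨t, rfl⟩

end Resolution

/-! ### Dimension shifting. -/

section ProjectiveDimension

variable {R : Type u} [Ring R]

theorem shortExact_ker {P M : Type u} [AddCommGroup P] [Module R P] [AddCommGroup M] [Module R M]
    {π : P →ₗ[R] M} (hπ : Function.Surjective π) :
    (ShortComplex.mk (ModuleCat.ofHom (LinearMap.ker π).subtype) (ModuleCat.ofHom π)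
      (by ext x; exact x.2)).ShortExact := by
  have : Mono (ModuleCat.ofHom (LinearMap.ker π).subtype) :=
    (ModuleCat.mono_iff_injective _).2 (Submodule.subtype_injective _)
  have : Epi (ModuleCat.ofHom π) := (ModuleCat.epi_iff_surjective _).2 hπ
  refine ShortComplex.ShortExact.mk ?_
  rw [ShortComplex.ShortExact.moduleCat_exact_iff_function_exact]
  exact LinearMap.exact_subtype_ker_map π

theorem hasProjectiveDimensionLT_of_ker {P M : Type u} [AddCommGroup P] [Module R P]
    [AddCommGroup M] [Module R M] {π : P →ₗ[R] M} (hπ : Function.Surjective π)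
    [Module.Projective R P] {n : ℕ}
    (h : HasProjectiveDimensionLT (ModuleCat.of R (LinearMap.ker π)) n) :
    HasProjectiveDimensionLT (ModuleCat.of R M) (n + 1) := by
  have : HasProjectiveDimensionLT (ModuleCat.of R P) 1 := inferInstance
  exact (shortExact_ker hπ).hasProjectiveDimensionLT_X₃ n h
    (inferInstanceAs (HasProjectiveDimensionLT (ModuleCat.of R P) (n + 1)))

/-- The shift starts at `n + 2`: when `M` is itself projective, the kernel is projective but need
not vanish. -/
theorem hasProjectiveDimensionLT_ker {P M : Type u} [AddCommGroup P] [Module R P]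
    [AddCommGroup M] [Module R M] {π : P →ₗ[R] M} (hπ : Function.Surjective π)
    [Module.Projective R P] {n : ℕ} (h : HasProjectiveDimensionLT (ModuleCat.of R M) (n + 2)) :
    HasProjectiveDimensionLT (ModuleCat.of R (LinearMap.ker π)) (n + 1) :=
  ((shortExact_ker hπ).hasProjectiveDimensionLT_X₃_iff n
    (inferInstanceAs (Projective (ModuleCat.of R P)))).1 h

end ProjectiveDimension

/-! ### Peeling off one stratum. -/

/-- A Casimir family for the corner of an idempotent `e`, together with an idempotent `e'`
orthogonal to `e` such that `e'` and `e + e'` generate two-sided ideals as left ideals and such that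
the left ideal of `e + e'` is relatively projective at `e`. -/
structure Stratum (k R ι : Type*) [Field k] [Ring R] [Algebra k R] [Fintype ι] extends
    CasimirFamily k R ι where
  e' : R
  e_mul_e' : e * e' = 0
  e'_mul_e : e' * e = 0
  mul_e' (r : R) : e' * r * e' = r * e'
  mul_add (r : R) : (e + e') * r * (e + e') = r * (e + e')
  exists_trace : ∃ φ : R →ₗ[k] R, ∀ r, toCasimirFamily.trace φ r = e * r * (e + e')

namespace Stratum

section

variable {k R ι : Type*} [Field k] [Ring R] [Algebra k R] [Fintype ι] (D : Stratum k R ι)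
  {M : Type*} [AddCommGroup M] [Module R M] [Module k M] [IsScalarTower k R M]

theorem e'_mul_e' : D.e' * D.e' = D.e' := by
  simpa using D.mul_e' 1

/-- Apply the trace formula for `R` coordinatewise on a free module, then pass to a direct summand.
The support condition lets the coordinates be multiplied on the right by `e + e'` without changing
their image in `M`. -/
theorem isRelProjective_of_projective [Module.Projective R M]
    (hM : ∀ m : M, (D.e + D.e') • m = m) : D.IsRelProjective M := by
  obtain ⟨φ, hφ⟩ := D.exists_trace
  obtain ⟨j, hj⟩ := (Module.projective_def' (R := R) (P := M)).1 inferInstance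
  let Ψ : (M →₀ R) →ₗ[k] (M →₀ R) := Finsupp.mapRange.linearMap φ
  let ρ : (M →₀ R) →ₗ[R] (M →₀ R) :=
    Finsupp.mapRange.linearMap (LinearMap.toSpanSingleton R R (D.e + D.e'))
  have hΨ (x : M →₀ R) : D.trace Ψ x = D.e • ρ x := by
    ext p
    have := D.trace_comp Ψ (Finsupp.lapply (R := R) p) x
    rw [Finsupp.lapply_apply] at this
    rw [← this, CasimirFamily.trace_apply]
    have h2 := hφ (x p)
    rw [CasimirFamily.trace_apply] at h2
    simpa [Ψ, ρ, mul_assoc] using h2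
  let τ : (M →₀ R) →ₗ[R] M := Finsupp.linearCombination R id
  have hρ : τ ∘ₗ ρ = τ := by
    ext p
    simpa [τ, ρ, add_smul] using hM p
  refine ⟨τ.restrictScalars k ∘ₗ Ψ ∘ₗ j.restrictScalars k, fun m => ?_⟩
  have h1 : D.trace (Ψ ∘ₗ j.restrictScalars k) m = D.trace Ψ (j m) := by
    simp [CasimirFamily.trace_apply]
  have h2 : τ (ρ (j m)) = m :=
    (LinearMap.congr_fun hρ (j m)).trans (LinearMap.congr_fun hj m)
  rw [CasimirFamily.trace_comp, h1, hΨ, map_smul, h2]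

theorem isRelProjective_of_subsingleton [Subsingleton M] : D.IsRelProjective M :=
  ⟨0, fun _ => Subsingleton.elim _ _⟩

end

variable {k ι : Type*} {R : Type u} [Field k] [Ring R] [Algebra k R] [Fintype ι]
  (D : Stratum k R ι)

theorem isRelProjective_of_hasProjectiveDimensionLT (n : ℕ) (M : Type u) [AddCommGroup M]
    [Module R M] [Module k M] [IsScalarTower k R M] (hM : ∀ m : M, (D.e + D.e') • m = m)
    (h : HasProjectiveDimensionLT (ModuleCat.of R M) n) : D.IsRelProjective M := by
  induction n using Nat.twoStepInduction generalizing M with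
  | zero =>
    have := ModuleCat.isZero_iff_subsingleton.1
      (isZero_of_hasProjectiveDimensionLT_zero (ModuleCat.of R M))
    have : Subsingleton M := this
    exact D.isRelProjective_of_subsingleton
  | one =>
    have h' := projective_iff_hasProjectiveDimensionLT_one.2 h
    have := (IsProjective.iff_projective M).2 h'
    exact D.isRelProjective_of_projective hM
  | more n _ ih =>
    let ε := D.e + D.e'
    have hε : ε * ε = ε := by simpa using D.mul_add 1
    -- The cover is `R(e + e') ⊗ M` rather than `R ⊗ M`, so that it and the kernel keep the support
    -- of `M`.
    let σ : M →ₗ[k] R ⊗[k] M := TensorProduct.mk k R M ε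
    have hσ (m : M) : extendLin (R := R) σ (σ m) = σ m := by
      simp [σ, smul_tmul', hε]
    obtain ⟨P, _, _, _, _, π, j, _, hπ, hj, hjσ, -⟩ := exists_projective_cover hσ hM
    have hsupp (q : P) : ε • q = q := by
      refine hj ?_
      obtain ⟨t, ht⟩ := hjσ q
      rw [map_smul, ht]
      exact smul_extendLin D.mul_add
        (fun m => by rw [mk_apply, smul_tmul', smul_eq_mul, hε]) t
    refine CasimirFamily.IsRelProjective.of_exact _ (Submodule.subtype_injective _) hπ
      (LinearMap.exact_subtype_ker_map π) (ih (LinearMap.ker π) ?_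
        (hasProjectiveDimensionLT_ker hπ h)) (D.isRelProjective_of_projective hsupp)
    intro x
    exact Subtype.ext (hsupp x)

theorem exists_cover (M : Type u) [AddCommGroup M]
    [Module R M] [Module k M] [IsScalarTower k R M] (hM : ∀ m : M, (D.e + D.e') • m = m)
    (hrel : D.IsRelProjective M) :
    ∃ (K : Type u) (_ : AddCommGroup K) (_ : Module R K) (_ : Module k K)
      (_ : IsScalarTower k R K), (∀ x : K, D.e' • x = x) ∧
      (∀ n, HasProjectiveDimensionLT (ModuleCat.of R K) n →
        HasProjectiveDimensionLT (ModuleCat.of R M) (n + 1)) ∧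
      (∀ n, HasProjectiveDimensionLT (ModuleCat.of R M) (n + 2) →
        HasProjectiveDimensionLT (ModuleCat.of R K) (n + 1)) := by
  obtain ⟨φ, hφ⟩ := hrel
  -- Tracing `m ↦ 1 ⊗ φ m` gives an `eRe`-linear lift of `e` through the action map. At `e'` no
  -- equivariance is needed, so `σ` there is simply `m ↦ e' ⊗ m`.
  let s : M →ₗ[k] R ⊗[k] M := D.trace (TensorProduct.mk k R M 1 ∘ₗ φ)
  have hs (m : M) : s m = ∑ i, D.fst i ⊗ₜ φ (D.snd i • m) := by
    simp [s, CasimirFamily.trace_apply, smul_tmul']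
  have hes (m : M) : D.e • s m = s m := D.e_smul_trace _ m
  have hse (m : M) : s (D.e • m) = s m := D.trace_e_smul _ m
  have hsc (r : R) (m : M) : s ((D.e * r * D.e) • m) = (D.e * r * D.e) • s m :=
    D.trace_smul _ r m
  have hfst (i : ι) : D.e * D.fst i * D.e = D.fst i := by rw [D.e_mul_fst, D.fst_mul_e]
  let σ : M →ₗ[k] R ⊗[k] M := s + TensorProduct.mk k R M D.e'
  have hσ' (m : M) : σ m = s m + D.e' ⊗ₜ m := rfl
  have he's (m : M) : D.e' • s m = 0 := by rw [← hes, ← mul_smul, D.e'_mul_e, zero_smul]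
  have hee' (r : R) : D.e * r * D.e' = 0 := by
    rw [mul_assoc, ← D.mul_e', ← mul_assoc, ← mul_assoc, D.e_mul_e', zero_mul, zero_mul]
  have hσ (m : M) : extendLin (R := R) σ (σ m) = σ m := by
    have h1 : extendLin (R := R) σ (s m) = s m := by
      conv_lhs => rw [hs]
      have h2 (i : ι) (y : M) : D.fst i • σ y = s (D.fst i • y) := by
        have h3 := hsc (D.fst i) y
        rw [hfst] at h3
        have h4 : D.fst i * D.e' = 0 := by rw [← D.e_mul_fst, hee']
        rw [h3, hσ', smul_add, smul_tmul', smul_eq_mul, h4, zero_tmul, add_zero]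
      simp only [map_sum, extendLin_tmul, h2]
      rw [← map_sum, ← CasimirFamily.trace_apply, hφ, hse]
    rw [hσ' m, map_add, h1, extendLin_tmul, hσ' m, smul_add, he's, zero_add, smul_tmul',
      smul_eq_mul, D.e'_mul_e']
  have hactS (m : M) : actionMap k R M (s m) = D.e • m := by
    rw [hs, ← hφ, CasimirFamily.trace_apply]
    simp
  have hact (m : M) : actionMap k R M (σ m) = m := by
    rw [hσ', map_add, hactS, actionMap_tmul, ← add_smul, hM]
  obtain ⟨P, _, _, _, _, π, j, _, hπ, hj, hjσ, hπj⟩ := exists_projective_cover hσ hact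
  have hsupp := smul_extendLin D.mul_add (σ := σ) fun m => by
    rw [hσ', smul_add, add_smul, hes, he's, add_zero, smul_tmul', smul_eq_mul, add_mul,
      D.e_mul_e', D.e'_mul_e', zero_add]
  -- At `e`, an element of the cover is recovered from its image in `M`. So `e` kills the kernel of
  -- `π`, and `e'` acts on it as the identity.
  have hker (t : R ⊗[k] M) : D.e • extendLin (R := R) σ t =
      s (D.e • actionMap k R M (extendLin (R := R) σ t)) := by
    induction t with
    | zero => simp
    | add x y hx hy => simp only [map_add, smul_add, hx, hy]
    | tmul r m =>
      rw [extendLin_tmul, (actionMap k R M).map_smul, hact, hσ', smul_add, smul_add, smul_tmul', smul_tmul',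
        smul_eq_mul, smul_eq_mul, ← mul_assoc, hee', zero_tmul, add_zero, ← hes m, ← mul_smul,
        ← mul_smul, ← hsc]
      have h1 : D.e • r • m = (D.e * r * D.e) • m + (D.e * r * D.e') • m := by
        rw [mul_smul _ D.e, mul_smul _ D.e', ← smul_add, ← add_smul, hM, mul_smul]
      rw [h1, hee', zero_smul, add_zero]
  refine ⟨LinearMap.ker π, inferInstance, inferInstance, inferInstance,
    inferInstance, ?_, fun n => hasProjectiveDimensionLT_of_ker hπ,
    fun n => hasProjectiveDimensionLT_ker hπ⟩
  rintro ⟨x, hx⟩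
  refine Subtype.ext (hj ?_)
  obtain ⟨t, ht⟩ := hjσ x
  have h1 := hker t
  rw [← ht, ← hπj, hx, smul_zero, map_zero] at h1
  have h2 := hsupp t
  rw [← ht, add_smul, h1, zero_add] at h2
  exact (map_smul j D.e' x).trans h2

end Stratum

/-! ### Chains of non-isomorphisms and levels. -/

section Chains

variable {C : Type u} [Category.{v} C]

/-- There is a chain of `n` non-isomorphisms starting at `x`. -/
def HasChain : ℕ → C → Prop
  | 0, _ => True
  | n + 1, x => ∃ (y : C) (f : x ⟶ y), ¬ IsIso f ∧ HasChain n y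

theorem HasChain.of_succ {n : ℕ} {x : C} (h : HasChain (n + 1) x) : HasChain n x := by
  induction n generalizing x with
  | zero => trivial
  | succ n ih =>
    obtain ⟨y, f, hf, hy⟩ := h
    exact ⟨y, f, hf, ih hy⟩

theorem HasChain.of_isIso {n : ℕ} {x y : C} (f : x ⟶ y) [IsIso f] (h : HasChain n y) :
    HasChain n x := by
  cases n with
  | zero => trivial
  | succ n =>
    obtain ⟨z, g, hg, hz⟩ := h
    exact ⟨z, f ≫ g, fun _ => hg (IsIso.of_isIso_comp_left f g), hz⟩

theorem HasChain.of_hom {n : ℕ} {x y : C} (f : x ⟶ y) (h : HasChain n y) : HasChain n x := by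
  by_cases hf : IsIso f
  · exact h.of_isIso f
  · exact HasChain.of_succ ⟨y, f, hf, h⟩

/-- The objects at which the longest chain of non-isomorphisms has length `n`. -/
def IsLevel (n : ℕ) (x : C) : Prop := HasChain n x ∧ ¬ HasChain (n + 1) x

theorem IsLevel.of_iso {n : ℕ} {x y : C} (f : x ≅ y) (h : IsLevel n x) : IsLevel n y :=
  ⟨h.1.of_isIso f.inv, fun h' => h.2 (h'.of_isIso f.hom)⟩

theorem isIso_of_hasChain {n : ℕ} {x y : C} (f : x ⟶ y) (hx : ¬ HasChain (n + 1) x)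
    (hy : HasChain n y) : IsIso f :=
  by_contra fun hf => hx ⟨y, f, hf, hy⟩

theorem HasChain.exists_composableArrows {n : ℕ} {x : C} (h : HasChain n x) :
    ∃ F : ComposableArrows C n, F.left = x ∧
      ∀ (i : ℕ) (hi : i < n), ¬ IsIso (F.map' i (i + 1)) := by
  induction n generalizing x with
  | zero => exact ⟨ComposableArrows.mk₀ x, rfl, fun i hi => absurd hi (by simp)⟩
  | succ n ih =>
    obtain ⟨y, f, hf, hy⟩ := h
    obtain ⟨F, rfl, hF⟩ := ih hy
    refine ⟨F.precomp f, rfl, fun i hi => ?_⟩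
    cases i with
    | zero => exact hf
    | succ i => exact hF i (by omega)

theorem HasChain.le_chainLength {n : ℕ} {x : C} (h : HasChain n x) : (n : ℕ∞) ≤ chainLength C := by
  obtain ⟨F, -, hF⟩ := h.exists_composableArrows
  exact le_iSup_of_le n (le_iSup_of_le F (le_iSup_of_le hF le_rfl))

/-- Both composites are endomorphisms, hence invertible, so `f` is split mono and epi. -/
theorem IsEICategory.isIso_of_hom (hC : IsEICategory C) {x y : C} (f : x ⟶ y) (g : y ⟶ x) :
    IsIso f := by
  have := hC x (f ≫ g)
  have := hC y (g ≫ f)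
  have : IsSplitMono f := IsSplitMono.mk' ⟨g ≫ inv (f ≫ g), by rw [← Category.assoc]; simp⟩
  have : Epi f := epi_of_epi g f
  exact isIso_of_epi_of_isSplitMono f

theorem IsEICategory.isIso_of_isIso_comp (hC : IsEICategory C) {x y z : C} (f : x ⟶ y) (g : y ⟶ z)
    [IsIso (f ≫ g)] : IsIso f ∧ IsIso g :=
  ⟨hC.isIso_of_hom f (g ≫ inv (f ≫ g)), hC.isIso_of_hom g (inv (f ≫ g) ≫ f)⟩

theorem chainLength_lt_top [Finite C] (hC : IsEICategory C) : chainLength C < ⊤ := by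
  refine lt_of_le_of_lt (iSup_le fun n => iSup_le fun F => iSup_le fun hF => ?_)
    (ENat.natCast_lt_top (Nat.card C))
  have hinj : Function.Injective F.obj := by
    intro i j hij
    wlog h : i ≤ j generalizing i j
    · exact (this hij.symm (le_of_not_ge h)).symm
    by_contra hne
    obtain ⟨i, hi⟩ := i
    obtain ⟨j, hj⟩ := j
    simp only [Fin.mk.injEq, Fin.mk_le_mk] at hne h
    -- If the chain revisits an object, the rest of the loop is a map back along its first step,
    -- which would make that step invertible.
    exact hF i (by omega) (hC.isIso_of_hom _
      (F.map' (i + 1) j (by omega) (by omega) ≫ eqToHom hij.symm))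
  have := Nat.card_le_card_of_injective _ hinj
  rw [Nat.card_fin] at this
  exact_mod_cast (Nat.le_succ n).trans this

theorem exists_isLevel [Finite C] (hC : IsEICategory C) (x : C) : ∃ n, IsLevel n x := by
  classical
  have h : ∃ n, ¬ HasChain n x := by
    obtain ⟨L, hL⟩ := ENat.ne_top_iff_exists.1 (chainLength_lt_top hC).ne
    refine ⟨L + 1, fun hx => ?_⟩
    have := hx.le_chainLength
    rw [← hL, Nat.cast_le] at this
    omega
  cases hn : Nat.find h with
  | zero => exact absurd trivial ((Nat.find_eq_zero h).1 hn)
  | succ n => exact ⟨n, not_not.1 (Nat.find_min h (by omega)), hn ▸ Nat.find_spec h⟩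

end Chains

/-! ### The strata of the category algebra. -/

namespace CategoryAlgebra

variable {k : Type uk} [Field k] {C : Type u} [Category.{v} C] [Fintype C]

theorem induction_on {p : CategoryAlgebra k C → Prop} (r : CategoryAlgebra k C) (zero : p 0)
    (add : ∀ a b, p a → p b → p (a + b)) (smul : ∀ (c : k) (a), p a → p (c • a))
    (of : ∀ {x y : C} (f : x ⟶ y), p (of f)) : p r := by
  have h : r ∈ Submodule.span k (Set.range (basis k C)) := by
    rw [Module.Basis.span_eq]; trivial
  induction h using Submodule.span_induction with
  | mem x h => obtain ⟨⟨x, y, f⟩, rfl⟩ := h; exact of f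
  | zero => exact zero
  | add a b _ _ ha hb => exact add a b ha hb
  | smul c a _ ha => exact smul c a ha

open Classical in
variable (k) in
/-- The idempotent of the category algebra given by a set of objects. -/
noncomputable def idem (p : C → Prop) : CategoryAlgebra k C := ∑ x, if p x then of (𝟙 x) else 0

open Classical in
theorem of_mul_idem {x y : C} (f : x ⟶ y) (p : C → Prop) :
    of f * idem k p = if p x then of f else 0 := by
  rw [idem, Finset.mul_sum, Finset.sum_eq_single x]
  · rw [mul_ite, of_mul_of, Category.id_comp, mul_zero]
  · intro z _ hz
    rw [mul_ite, of_mul_of_ne _ _ hz, mul_zero, ite_self]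
  · simp

open Classical in
theorem idem_mul_of {x y : C} (f : x ⟶ y) (p : C → Prop) :
    idem k p * of f = if p y then of f else 0 := by
  rw [idem, Finset.sum_mul, Finset.sum_eq_single y]
  · rw [ite_mul, of_mul_of, Category.comp_id, zero_mul]
  · intro z _ hz
    rw [ite_mul, of_mul_of_ne _ _ hz.symm, zero_mul, ite_self]
  · simp

theorem idem_mul_idem (p q : C → Prop) :
    (idem k p * idem k q : CategoryAlgebra k C) = idem k fun x => p x ∧ q x := by
  classical
  conv_lhs => rw [idem, Finset.sum_mul]
  refine Finset.sum_congr rfl fun x _ => ?_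
  rw [ite_mul, of_mul_idem, zero_mul]
  by_cases hp : p x <;> simp [hp]

theorem idem_add_idem {p q : C → Prop} (h : ∀ x, p x → ¬ q x) :
    (idem k p + idem k q : CategoryAlgebra k C) = idem k fun x => p x ∨ q x := by
  classical
  rw [idem, idem, idem, ← Finset.sum_add_distrib]
  refine Finset.sum_congr rfl fun x _ => ?_
  by_cases hp : p x
  · simp [hp, h x hp]
  · simp [hp]

/-- A morphism starting in a set of objects closed under targets also ends in it. -/
theorem idem_mul_mul_idem {p : C → Prop} (hp : ∀ {x y : C}, (x ⟶ y) → p x → p y)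
    (r : CategoryAlgebra k C) : idem k p * r * idem k p = r * idem k p := by
  induction r using induction_on with
  | zero => simp
  | add a b ha hb => rw [mul_add, add_mul, ha, hb, add_mul]
  | smul c a ha => rw [mul_smul_comm, smul_mul_assoc, ha, smul_mul_assoc]
  | of f =>
    rw [mul_assoc, of_mul_idem]
    split_ifs with h
    · rw [idem_mul_of, if_pos (hp f h)]
    · rw [mul_zero]

theorem idem_false : (idem k (fun _ : C => False) : CategoryAlgebra k C) = 0 := by
  simp [idem]

theorem idem_true : (idem k (fun _ : C => True) : CategoryAlgebra k C) = 1 := by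
  simp [idem, one_def]

open Classical in
variable (k C) in
/-- The projection onto the identities at objects without chains of length `n + 1`. -/
noncomputable def idProj (n : ℕ) : CategoryAlgebra k C →ₗ[k] CategoryAlgebra k C :=
  (basis k C).constr k fun m =>
    if m = ⟨m.1, m.1, 𝟙 m.1⟩ ∧ ¬ HasChain (n + 1) m.1 then basis k C m else 0

open Classical in
theorem idProj_of {n : ℕ} {x y : C} (f : x ⟶ y) : idProj k C n (of f) =
    if (⟨x, y, f⟩ : Mor C) = ⟨x, x, 𝟙 x⟩ ∧ ¬ HasChain (n + 1) x then of f else 0 := by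
  rw [idProj, of, Module.Basis.constr_basis]

theorem level_add (n : ℕ) :
    (idem k (IsLevel n) + idem k (fun x => ¬ HasChain n x) : CategoryAlgebra k C) =
      idem k fun x => ¬ HasChain (n + 1) x := by
  rw [idem_add_idem fun x hx h => h hx.1]
  congr
  ext x
  have := HasChain.of_succ (n := n) (x := x)
  unfold IsLevel
  tauto

variable [∀ x y : C, Finite (x ⟶ y)]

variable (C) in
/-- The isomorphisms between objects at level `n`. -/
abbrev LevelIso (n : ℕ) := Σ (x : {x : C // IsLevel n x}) (y : C), x.1 ≅ y

instance (x y : C) : Finite (x ≅ y) :=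
  Finite.of_injective (fun f => f.hom) fun _ _ h => Iso.ext h

noncomputable instance (n : ℕ) : Fintype {x : C // IsLevel n x} := Fintype.ofFinite _

noncomputable instance (x y : C) : Fintype (x ≅ y) := Fintype.ofFinite _

theorem sum_levelIso {A : Type*} [AddCommMonoid A] {n : ℕ} (F : LevelIso C n → A) :
    ∑ i, F i = ∑ x : {x : C // IsLevel n x}, ∑ y : C, ∑ g : x.1 ≅ y, F ⟨x, y, g⟩ := by
  rw [Fintype.sum_sigma]
  exact Finset.sum_congr rfl fun x _ => Fintype.sum_sigma _

theorem sum_levelIso_eq {A : Type*} [AddCommMonoid A] {n : ℕ} (F : LevelIso C n → A) (y : C)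
    (hF : ∀ i, i.2.1 ≠ y → F i = 0) :
    ∑ i, F i = ∑ x : {x : C // IsLevel n x}, ∑ g : x.1 ≅ y, F ⟨x, y, g⟩ := by
  rw [sum_levelIso]
  refine Finset.sum_congr rfl fun x _ => ?_
  rw [Finset.sum_eq_single y _ (by simp)]
  exact fun z _ hz => Finset.sum_eq_zero fun g _ => hF _ hz

variable (k C) in
/-- The Casimir family of the groupoid of objects at level `n`. -/
noncomputable def levelFamily (n : ℕ) :
    CasimirFamily k (CategoryAlgebra k C) (LevelIso C n) where
  fst i := of i.2.2.hom
  snd i := of i.2.2.inv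
  e := idem k (IsLevel n)
  e_mul_fst i := by rw [idem_mul_of, if_pos (i.1.2.of_iso i.2.2)]
  fst_mul_e i := by rw [of_mul_idem, if_pos i.1.2]
  e_mul_snd i := by rw [idem_mul_of, if_pos i.1.2]
  snd_mul_e i := by rw [of_mul_idem, if_pos (i.1.2.of_iso i.2.2)]
  e_mul_e := by rw [idem_mul_idem]; simp only [and_self]
  casimir r := by
    classical
    induction r using induction_on with
    | zero => simp
    | add a b ha hb =>
      simp only [mul_add, add_mul, tmul_add, add_tmul, Finset.sum_add_distrib, ha, hb]
    | smul c a ha =>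
      simp only [mul_smul_comm, smul_mul_assoc, tmul_smul, ← smul_tmul', ← Finset.smul_sum, ha]
    | of f =>
      rename_i u v
      rw [idem_mul_of, ite_mul, zero_mul, of_mul_idem]
      split_ifs with hv hu
      · have : IsIso f := isIso_of_hasChain f hu.2 hv.1
        rw [sum_levelIso_eq _ v, sum_levelIso_eq _ u]
        -- Both sums run over isomorphisms out of `x`, into `v` and into `u`; composition with the
        -- isomorphism `f` matches them.
        · refine Finset.sum_congr rfl fun x _ => ?_
          refine Fintype.sum_equiv
            ⟨fun g => g ≪≫ (asIso f).symm, fun g => g ≪≫ asIso f, fun g => by ext; simp,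
              fun g => by ext; simp⟩ _ _ fun g => ?_
          rw [of_mul_of, of_mul_of]
          simp
        · intro i hi
          rw [of_mul_of_ne _ _ hi, zero_tmul]
        · intro i hi
          rw [of_mul_of_ne _ _ hi.symm, tmul_zero]
      all_goals simp

/-- For a basis morphism `h` from level at most `n` into level `n`, `h` is invertible, and `g⁻¹ h`
is an identity only for `g = h`, so the trace returns `h`. -/
theorem trace_idProj (n : ℕ) (r : CategoryAlgebra k C) :
    (levelFamily k C n).trace (idProj k C n) r =
      idem k (IsLevel n) * r * idem k fun x => ¬ HasChain (n + 1) x := by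
  classical
  induction r using induction_on with
  | zero => simp
  | add a b ha hb => simp only [map_add, ha, hb, mul_add, add_mul]
  | smul c a ha => simp only [map_smul, ha, mul_smul_comm, smul_mul_assoc]
  | of h =>
    rename_i x y
    rw [CasimirFamily.trace_apply, idem_mul_of, ite_mul, zero_mul, of_mul_idem, sum_levelIso_eq _ y]
    · simp only [levelFamily, smul_eq_mul, of_mul_of, idProj_of]
      by_cases hx : HasChain (n + 1) x
      · simp [hx]
      by_cases hy : IsLevel n y
      · have hh : IsIso h := isIso_of_hasChain h hx hy.1
        have hx' : IsLevel n x := ⟨hy.1.of_isIso h, hx⟩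
        rw [if_pos hy, if_pos hx, Finset.sum_eq_single ⟨x, hx'⟩, Finset.sum_eq_single (asIso h)]
        · simp [of_mul_of, hx]
        · intro g _ hg
          rw [if_neg, mul_zero]
          rintro ⟨h1, -⟩
          simp only [Sigma.mk.injEq, heq_eq_eq, true_and] at h1
          apply hg
          ext
          rw [asIso_hom, ← (Iso.comp_inv_eq_id g).1 h1]
        · simp
        · intro z _ hz
          refine Finset.sum_eq_zero fun g _ => ?_
          rw [if_neg, mul_zero]
          rintro ⟨h1, -⟩
          apply hz
          exact Subtype.ext (congrArg (fun m : Mor C => m.2.1) h1)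
        · simp
      · rw [if_neg hy]
        exact Finset.sum_eq_zero fun z _ => Finset.sum_eq_zero fun g _ =>
          absurd (z.2.of_iso g) hy
    · intro i hi
      simp only [levelFamily, smul_eq_mul]
      rw [of_mul_of_ne _ _ hi.symm, map_zero, mul_zero]

variable (k C) in
/-- The stratum of the category algebra at level `n`. -/
noncomputable def levelStratum (n : ℕ) : Stratum k (CategoryAlgebra k C) (LevelIso C n) where
  toCasimirFamily := levelFamily k C n
  e' := idem k fun x => ¬ HasChain n x
  e_mul_e' := by
    change idem k (IsLevel n) * _ = _
    rw [idem_mul_idem, ← idem_false]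
    congr
    ext x
    simp +contextual [IsLevel]
  e'_mul_e := by
    change _ * idem k (IsLevel n) = _
    rw [idem_mul_idem, ← idem_false]
    congr
    ext x
    simp +contextual [IsLevel]
  mul_e' := idem_mul_mul_idem fun f hx hy => hx (hy.of_hom f)
  mul_add r := by
    change (idem k (IsLevel n) + _) * _ * (idem k (IsLevel n) + _) = _ * (idem k (IsLevel n) + _)
    rw [level_add]
    exact idem_mul_mul_idem (fun f hx hy => hx (hy.of_hom f)) r
  exists_trace := ⟨idProj k C n, fun r => by
    change _ = idem k (IsLevel n) * _ * (idem k (IsLevel n) + _)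
    rw [trace_idProj, level_add]⟩

end CategoryAlgebra

theorem card_iso_eq_card_aut {C : Type u} [Category.{v} C] {x y : C} (f : x ≅ y) :
    Nat.card (x ≅ y) = Nat.card (Aut x) :=
  Nat.card_congr (Iso.isoCongrRight f.symm)

theorem card_iso_eq_card_aut' {C : Type u} [Category.{v} C] {x y : C} (f : x ≅ y) :
    Nat.card (x ≅ y) = Nat.card (Aut y) :=
  Nat.card_congr (Iso.isoCongrLeft f)

namespace CategoryAlgebra

variable {k : Type uk} [Field k] {C : Type u} [Category.{v} C]

/-! ### The trivial representation on an isomorphism class. -/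

section Trivial

variable (k)

/-- The type of objects isomorphic to `x₀`, in a universe matching the category algebra. -/
abbrev IsoClass (x₀ : C) := ULift.{v} {y : C // Nonempty (x₀ ≅ y)}

open Classical in
/-- The action of a morphism on the functions on the isomorphism class of `x₀`. -/
noncomputable def trivialMor (x₀ : C) {x y : C} (f : x ⟶ y) : Module.End k (IsoClass x₀ → k) :=
  if h : IsIso f ∧ Nonempty (x₀ ≅ x) then
    LinearMap.single k (fun _ => k) ⟨y, h.2.map fun g => g ≪≫ @asIso _ _ _ _ f h.1⟩ ∘ₗ
      LinearMap.proj ⟨x, h.2⟩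
  else 0

open Classical in
theorem trivialMor_iso {x₀ x y : C} (f : x ≅ y) (hx : Nonempty (x₀ ≅ x)) (hy : Nonempty (x₀ ≅ y)) :
    trivialMor k x₀ f.hom =
      LinearMap.single k (fun _ => k) ⟨y, hy⟩ ∘ₗ LinearMap.proj ⟨x, hx⟩ :=
  dif_pos ⟨inferInstance, hx⟩

theorem trivialMor_of_isEmpty {x₀ x y : C} (f : x ⟶ y) (hx : ¬ Nonempty (x₀ ≅ x)) :
    trivialMor k x₀ f = 0 :=
  dif_neg fun h => hx h.2

theorem trivialMor_of_not_isIso {x₀ x y : C} (f : x ⟶ y) (hf : ¬ IsIso f) :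
    trivialMor k x₀ f = 0 :=
  dif_neg fun h => hf h.1

/-- Letting non-isomorphisms act by zero is functorial because, in an EI category, both factors of
an invertible composite are invertible. -/
theorem trivialMor_comp (hC : IsEICategory C) {x₀ x y z : C} (f : x ⟶ y) (g : y ⟶ z) :
    trivialMor k x₀ (f ≫ g) = trivialMor k x₀ g * trivialMor k x₀ f := by
  classical
  by_cases h : IsIso f ∧ IsIso g
  · obtain ⟨hf, hg⟩ := h
    by_cases hx : Nonempty (x₀ ≅ x)
    · have hy : Nonempty (x₀ ≅ y) := hx.map fun i => i ≪≫ asIso f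
      have hz : Nonempty (x₀ ≅ z) := hy.map fun i => i ≪≫ asIso g
      have h1 := trivialMor_iso k (asIso f) hx hy
      have h2 := trivialMor_iso k (asIso g) hy hz
      have h3 := trivialMor_iso k (asIso f ≪≫ asIso g) hx hz
      simp only [asIso_hom, Iso.trans_hom] at h1 h2 h3
      rw [h1, h2, h3]
      ext v i
      simp
    · rw [trivialMor_of_isEmpty k _ hx, trivialMor_of_isEmpty k f hx, mul_zero]
  · rw [trivialMor_of_not_isIso k (f ≫ g) fun h' => h (hC.isIso_of_isIso_comp f g)]
    by_cases hf : IsIso f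
    · rw [trivialMor_of_not_isIso k g fun hg => h ⟨hf, hg⟩, zero_mul]
    · rw [trivialMor_of_not_isIso k f hf, mul_zero]

theorem trivialMor_mul_of_ne {x₀ x y y' z : C} (f : x ⟶ y) (g : y' ⟶ z) (h : y ≠ y') :
    trivialMor k x₀ g * trivialMor k x₀ f = 0 := by
  classical
  unfold trivialMor
  split_ifs
  · ext v i
    simp [Pi.single_apply, h.symm]
  all_goals simp

/-- The `k`-linear extension of `trivialMor`. -/
noncomputable def trivialLin (x₀ : C) : CategoryAlgebra k C →ₗ[k] Module.End k (IsoClass x₀ → k) :=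
  (basis k C).constr k fun m => trivialMor k x₀ m.2.2

theorem trivialLin_of (x₀ : C) {x y : C} (f : x ⟶ y) :
    trivialLin k x₀ (of f) = trivialMor k x₀ f := by
  rw [trivialLin, of, Module.Basis.constr_basis]

variable [Fintype C]

theorem trivialLin_idem {x₀ : C} {p : C → Prop} (hp : ∀ y, Nonempty (x₀ ≅ y) → p y) :
    trivialLin k x₀ (idem k p) = 1 := by
  classical
  have h1 (x : C) : trivialLin k x₀ (if p x then of (𝟙 x) else 0) = trivialMor k x₀ (𝟙 x) := by
    split_ifs with h
    · rw [trivialLin_of]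
    · rw [map_zero, trivialMor_of_isEmpty k _ fun h' => h (hp x h')]
  rw [idem, map_sum]
  simp only [h1]
  refine LinearMap.ext fun v => funext fun i => ?_
  obtain ⟨y, hy⟩ := i
  rw [LinearMap.sum_apply, Finset.sum_apply, Finset.sum_eq_single y _ (by simp)]
  · have := trivialMor_iso k (Iso.refl y) hy hy
    rw [Iso.refl_hom] at this
    simp [this]
  · intro z _ hz
    unfold trivialMor
    split_ifs
    · simp [hz.symm]
    · simp

/-- The representation of the category algebra on the functions on the isomorphism class of `x₀`,
on which automorphisms act trivially. -/
noncomputable def trivialRep (hC : IsEICategory C) (x₀ : C) :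
    CategoryAlgebra k C →ₐ[k] Module.End k (IsoClass x₀ → k) :=
  AlgHom.ofLinearMap (trivialLin k x₀)
    (by rw [← idem_true]; exact trivialLin_idem k fun _ _ => trivial)
    (by
      intro a b
      induction a using induction_on with
      | zero => simp
      | add a a' h h' => rw [add_mul, map_add, h, h', map_add, add_mul]
      | smul c a h => rw [smul_mul_assoc, map_smul, h, map_smul, smul_mul_assoc]
      | of g =>
        rename_i y' z
        induction b using induction_on with
        | zero => simp
        | add a a' h h' => rw [mul_add, map_add, h, h', map_add, mul_add]
        | smul c a h => rw [mul_smul_comm, map_smul, h, map_smul, mul_smul_comm]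
        | of f =>
          rename_i x y
          rw [trivialLin_of, trivialLin_of]
          by_cases h : y = y'
          · subst h
            rw [of_mul_of, trivialLin_of, trivialMor_comp k hC]
          · rw [of_mul_of_ne _ _ h, map_zero, trivialMor_mul_of_ne k _ _ h])

end Trivial

/-! ### Orders of automorphism groups and the dimension bound. -/

variable [Fintype C] [∀ x y : C, Finite (x ⟶ y)]

/-- If the orders of all automorphism groups are invertible, every module is relatively
projective. -/
theorem isRelProjective_of_isUnit (hu : ∀ x : C, IsUnit (Nat.card (Aut x) : k)) (n : ℕ)
    (M : Type*) [AddCommGroup M] [Module (CategoryAlgebra k C) M] [Module k M]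
    [IsScalarTower k (CategoryAlgebra k C) M] : (levelStratum k C n).IsRelProjective M := by
  classical
  let rep (x : C) : C := (Quotient.mk (isIsomorphicSetoid C) x).out
  have hrep (x : C) : Nonempty (rep x ≅ x) := Quotient.mk_out (s := isIsomorphicSetoid C) x
  have hrep' {x y : C} (f : x ≅ y) : rep x = rep y :=
    congrArg Quotient.out (Quotient.sound (s := isIsomorphicSetoid C) ⟨f⟩)
  -- Only one representative per isomorphism class gets weight. Spreading it over the class could
  -- require dividing by the size of the class, which may vanish in `k`.
  let c (x : C) : k := if rep x = x then (Nat.card (Aut x) : k)⁻¹ else 0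
  let w : CategoryAlgebra k C := ∑ x, c x • of (𝟙 x)
  have hw {x y : C} (f : x ⟶ y) : w * of f = c y • of f := by
    rw [Finset.sum_mul, Finset.sum_eq_single y]
    · rw [smul_mul_assoc, of_mul_of, Category.comp_id]
    · intro z _ hz
      rw [smul_mul_assoc, of_mul_of_ne _ _ hz.symm, smul_zero]
    · simp
  have key : ∑ i : LevelIso C n, (of i.2.2.hom * (w * of i.2.2.inv) : CategoryAlgebra k C) =
      idem k (IsLevel n) := by
    simp only [hw, mul_smul_comm, of_mul_of, Iso.inv_hom_id]
    rw [sum_levelIso, Finset.sum_comm, idem]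
    refine Finset.sum_congr rfl fun y _ => ?_
    split_ifs with hy
    · obtain ⟨f⟩ := hrep y
      rw [Finset.sum_eq_single ⟨rep y, hy.of_iso f.symm⟩ _ (by simp)]
      · have h1 : c (rep y) = (Nat.card (Aut (rep y)) : k)⁻¹ := if_pos (hrep' f)
        refine (Finset.sum_const (c (rep y) • of (𝟙 y))).trans ?_
        rw [Finset.card_univ, ← Nat.card_eq_fintype_card,
          card_iso_eq_card_aut f, ← Nat.cast_smul_eq_nsmul k, smul_smul, h1,
          mul_inv_cancel₀ (hu _).ne_zero, one_smul]
      · intro x _ hx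
        refine Finset.sum_eq_zero fun g _ => ?_
        have h1 : c x.1 = 0 := if_neg fun h => hx (Subtype.ext (h.symm.trans (hrep' g)))
        rw [h1, zero_smul]
    · exact Finset.sum_eq_zero fun x _ => Finset.sum_eq_zero fun g _ => absurd (x.2.of_iso g) hy
  refine ⟨Algebra.lsmul k k M w, fun m => ?_⟩
  rw [CasimirFamily.trace_apply]
  change ∑ i : LevelIso C n, (of i.2.2.hom : CategoryAlgebra k C) •
    w • (of i.2.2.inv : CategoryAlgebra k C) • m = idem k (IsLevel n) • m
  simp only [← mul_smul]
  rw [← Finset.sum_smul, key]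

theorem isUnit_card_aut_of_hasProjectiveDimensionLT (hC : IsEICategory C)
    (hfin : ∀ M : ModuleCat.{max uk u v} (CategoryAlgebra k C),
      ∃ N, HasProjectiveDimensionLT M N) {n : ℕ} {x₀ : C} (hx₀ : IsLevel n x₀) :
    IsUnit (Nat.card (Aut x₀) : k) := by
  classical
  let V := IsoClass x₀ → k
  let ρ := trivialRep k hC x₀
  let : Module (CategoryAlgebra k C) V := Module.compHom V ρ.toRingHom
  have hρ (r : CategoryAlgebra k C) (m : V) : r • m = trivialLin k x₀ r m := rfl
  have : IsScalarTower k (CategoryAlgebra k C) V :=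
    ⟨fun c r m => by rw [hρ, hρ, map_smul, LinearMap.smul_apply]⟩
  obtain ⟨N, hN⟩ := hfin (ModuleCat.of _ V)
  obtain ⟨φ, hφ⟩ := (levelStratum k C n).isRelProjective_of_hasProjectiveDimensionLT N V
    (fun m => by
      change (idem k (IsLevel n) + idem k _) • m = m
      rw [level_add, hρ, trivialLin_idem k fun y hy => (hx₀.of_iso hy.some).2]
      rfl) hN
  have hx₀' : Nonempty (x₀ ≅ x₀) := ⟨Iso.refl _⟩
  have h1 := congrFun (hφ (Pi.single ⟨x₀, hx₀'⟩ 1)) ⟨x₀, hx₀'⟩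
  have h2 : (levelStratum k C n).e = idem k (IsLevel n) := rfl
  rw [h2, hρ, trivialLin_idem k fun y hy => hx₀.of_iso hy.some, Module.End.one_apply,
    Pi.single_eq_same, CasimirFamily.trace_apply, sum_levelIso_eq _ x₀] at h1
  -- These are the diagonal entries of `φ`. Evaluated at `x₀`, the trace equation reads `1 = |Aut
  -- x₀| * ∑ a x`, since each object isomorphic to `x₀` contributes `|Aut x₀|` equal terms and the
  -- others have `a x = 0`.
  · let a (x : C) : k :=
      if h : Nonempty (x₀ ≅ x) then φ (Pi.single ⟨x, h⟩ 1) ⟨x, h⟩ else 0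
    refine IsUnit.of_mul_eq_one (∑ x : {x : C // IsLevel n x}, a x.1) ?_
    rw [← h1, Finset.mul_sum, Finset.sum_apply]
    refine Finset.sum_congr rfl fun x _ => ?_
    rw [Finset.sum_apply]
    by_cases hx : Nonempty (x₀ ≅ x.1)
    · obtain ⟨f⟩ := id hx
      have h3 (g : x.1 ≅ x₀) : (trivialLin k x₀ (of g.hom)
          (φ (trivialLin k x₀ (of g.inv) (Pi.single ⟨x₀, hx₀'⟩ 1)))) ⟨x₀, hx₀'⟩ = a x.1 := by
        have h4 := trivialMor_iso k g.symm hx₀' hx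
        rw [Iso.symm_hom] at h4
        rw [trivialLin_of, trivialLin_of, trivialMor_iso k g hx hx₀', h4]
        simp [a, hx]
      refine Eq.symm ((Finset.sum_congr rfl fun g _ => h3 g).trans ?_)
      rw [Finset.sum_const, Finset.card_univ, ← Nat.card_eq_fintype_card, nsmul_eq_mul,
        card_iso_eq_card_aut' f.symm]
    · have h3 : a x.1 = 0 := dif_neg hx
      rw [h3, mul_zero]
      exact (Finset.sum_eq_zero fun g _ => absurd ⟨g.symm⟩ hx).symm
  · intro i hi
    have h3 : trivialLin k x₀ (of i.2.2.inv) (Pi.single ⟨x₀, hx₀'⟩ 1) = 0 := by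
      rw [trivialLin_of]
      unfold trivialMor
      split_ifs
      · simp [hi]
      · rfl
    change trivialLin k x₀ (of i.2.2.hom) (φ (trivialLin k x₀ (of i.2.2.inv) _)) = 0
    rw [h3, map_zero, map_zero]

/-- Induction on the support: the kernel of the cover loses the top level. Either alternative yields
relative projectivity, and the second passes to the kernel by dimension shifting. -/
theorem hasProjectiveDimensionLT_of_support (n : ℕ) (M : Type max uk u v) [AddCommGroup M]
    [Module (CategoryAlgebra k C) M] [Module k M] [IsScalarTower k (CategoryAlgebra k C) M]
    (hM : ∀ m : M, idem k (fun x : C => ¬ HasChain n x) • m = m)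
    (h : (∀ x : C, IsUnit (Nat.card (Aut x) : k)) ∨
      ∃ N, HasProjectiveDimensionLT (ModuleCat.of (CategoryAlgebra k C) M) N) :
    HasProjectiveDimensionLT (ModuleCat.of (CategoryAlgebra k C) M) n := by
  induction n generalizing M with
  | zero =>
    have h0 : (idem k (fun x : C => ¬ HasChain 0 x) : CategoryAlgebra k C) = 0 := by
      simp [idem, HasChain]
    have : Subsingleton M := subsingleton_of_forall_eq 0 fun m => by rw [← hM m, h0, zero_smul]
    exact (ModuleCat.isZero_of_subsingleton
      (ModuleCat.of (CategoryAlgebra k C) M)).hasProjectiveDimensionLT_zero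
  | succ n ih =>
    have hM' (m : M) : ((levelStratum k C n).e + (levelStratum k C n).e') • m = m := by
      change (idem k (IsLevel n) + idem k _) • m = m
      rw [level_add, hM]
    have hrel : (levelStratum k C n).IsRelProjective M := by
      obtain h | ⟨N, hN⟩ := h
      · exact isRelProjective_of_isUnit h n M
      · exact (levelStratum k C n).isRelProjective_of_hasProjectiveDimensionLT N M hM' hN
    obtain ⟨K, _, _, _, _, hK, h1, h2⟩ := (levelStratum k C n).exists_cover M hM' hrel
    refine h1 n (ih K hK (h.imp id ?_))
    rintro ⟨N, hN⟩
    exact ⟨N + 1, h2 N (hasProjectiveDimensionLT_of_ge _ N (N + 2) (by omega))⟩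

theorem projectiveDimension_le_chainLength (hC : IsEICategory C)
    (M : ModuleCat.{max uk u v} (CategoryAlgebra k C))
    (h : (∀ x : C, IsUnit (Nat.card (Aut x) : k)) ∨ projectiveDimension M < ⊤) :
    projectiveDimension M ≤ (chainLength C : WithBot ℕ∞) := by
  obtain ⟨L, hL⟩ := ENat.ne_top_iff_exists.1 (chainLength_lt_top hC).ne
  have hchain (x : C) : ¬ HasChain (L + 1) x := fun hx => by
    have := hx.le_chainLength
    rw [← hL, Nat.cast_le] at this
    omega
  let : Module k M := Module.compHom M (algebraMap k (CategoryAlgebra k C))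
  have : IsScalarTower k (CategoryAlgebra k C) M := IsScalarTower.of_algebraMap_smul fun _ _ => rfl
  rw [← hL]
  refine (projectiveDimension_le_iff M L).2
    -- No object starts a chain of length `L + 1`, so every module satisfies the support condition
    -- at `L + 1`.
    (hasProjectiveDimensionLT_of_support (L + 1) M (fun m => ?_) (h.imp id fun h => ?_))
  · simp only [hchain, not_false_eq_true]
    rw [idem_true, one_smul]
  · obtain ⟨n, hn⟩ := (projectiveDimension_ne_top_iff M).1 h.ne
    exact ⟨n + 1, hn⟩

end CategoryAlgebra

theorem mainTheorem1 {k : Type uk} [Field k] {C : Type u} [Category.{v} C] [Finite C]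
    [∀ x y : C, Finite (x ⟶ y)] (hC : IsEICategory C) :
    (globalDimension (CategoryAlgebra k C) < ⊤ ↔
      ∀ x : C, IsUnit (Nat.card (Aut x) : k)) ∧
    chainLength C < ⊤ ∧
    bigFinitisticDimension (CategoryAlgebra k C) ≤ (chainLength C : WithBot ℕ∞) := by
  have := Fintype.ofFinite C
  have hlt := chainLength_lt_top hC
  refine ⟨⟨fun h x => ?_, fun h => ?_⟩, hlt, iSup_le fun M => iSup_le fun hM =>
    CategoryAlgebra.projectiveDimension_le_chainLength hC M (Or.inr hM)⟩
  · obtain ⟨n, hn⟩ := exists_isLevel hC x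
    refine CategoryAlgebra.isUnit_card_aut_of_hasProjectiveDimensionLT hC (fun M => ?_) hn
    obtain ⟨N, hN⟩ := (projectiveDimension_ne_top_iff M).1
      ((le_iSup (fun M => projectiveDimension M) M).trans_lt h).ne
    exact ⟨N + 1, hN⟩
  · refine lt_of_le_of_lt (iSup_le fun M =>
      CategoryAlgebra.projectiveDimension_le_chainLength hC M (Or.inl h)) ?_
    exact WithBot.coe_lt_coe.2 hlt
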